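/- Let $K$ be a number field with ring of integers $\mathcal{O}_K$, and let $R$ be an order in $K$, that is, a subring of $\mathcal{O}_K$ that spans $K$ over $\mathbb{Q}$; its integral closure is $\overline{R}=\mathcal{O}_K$. Suppose that $R$ is an associated order, i.e. every $t\in\overline{R}$ can be written as $t=ru$ with $r\in R$ and $u\in U(\overline{R})$ a unit of $\overline{R}$, and that the conductor ideal $I=(R:\overline{R})=\{t\in\overline{R} : t\overline{R}\subseteq R\}$ is a radical ideal of $\overline{R}$. For an integral domain $A$ and a nonzero nonunit $a\in A$, let $\ell_A(a)$ be the set of all $n$ such that $a$ is a product of $n$ irreducible elements of $A$. The elasticity of $a$ in $A$ is $\rho_A(a)=\sup\{m/n : m,n\in\ell_A(a)\}\in[1,\infty]$ (when $A$ is atomic), and the elasticity of $A$ is $\rho(A)=\sup\{\rho_A(a) : a\in A \text{ a nonzero nonunit}\}$. Then for every nonzero nonunit $f\in R[[x]]$, $$\rho_{R[[x]]}(f)=\rho_{\overline{R}[[x]]}(f).$$ Moreover, $\rho(R[[x]])=\rho(\overline{R}[[x]])$. -/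

import Mathlib

open scoped NumberField ENNReal

namespace OrderElasticity

/-- A subring `R` of the ring of integers of a number field `K` is an order in `K` if it has full
rank, that is, if it spans `K` over `ℚ`. (Every order in `K` is contained in `𝓞 K`, subgroups of
`𝓞 K` are automatically finitely generated, and the integral closure of an order is `𝓞 K`.) -/
def IsOrder (K : Type*) [Field K] [NumberField K] (R : Subring (𝓞 K)) : Prop :=
  Submodule.span ℚ ((fun a : 𝓞 K => (a : K)) '' (R : Set (𝓞 K))) = ⊤

/-- The conductor `(R : T)` of a subring `R` of `T`, as an ideal of `T`. -/
def conductorIdeal {T : Type*} [CommRing T] (R : Subring T) : Ideal T where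
  carrier := {t | ∀ s : T, t * s ∈ R}
  zero_mem' := fun s => by simp [R.zero_mem]
  add_mem' := fun ha hb s => by
    rw [add_mul]
    exact R.add_mem (ha s) (hb s)
  smul_mem' := fun c a ha s => by
    have h := ha (c * s)
    rwa [show a * (c * s) = c • a * s by rw [smul_eq_mul]; ring] at h

/-- `R` is an associated subring of `T` if `T = R · U(T)`. -/
def IsAssociatedSubring {T : Type*} [CommRing T] (R : Subring T) : Prop :=
  ∀ t : T, ∃ r ∈ R, ∃ u : Tˣ, t = r * u

/-- The set of lengths of the factorizations of `a` into irreducible elements of `A`. -/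
def lengthSet {A : Type*} [CommRing A] (a : A) : Set ℕ :=
  {n | ∃ s : Multiset A, (∀ p ∈ s, Irreducible p) ∧ s.prod = a ∧ Multiset.card s = n}

/-- The elasticity `ρ_A(a) = sup {m / n}` of an element, over all pairs of lengths `m`, `n` of
factorizations of `a` into irreducibles; it may be infinite. -/
noncomputable def elemElasticity {A : Type*} [CommRing A] (a : A) : ℝ≥0∞ :=
  ⨆ m ∈ lengthSet a, ⨆ n ∈ lengthSet a, (m : ℝ≥0∞) / (n : ℝ≥0∞)

/-- The elasticity `ρ(A)` of a ring, the supremum of the elasticities of its nonzero nonunits. -/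
noncomputable def ringElasticity (A : Type*) [CommRing A] : ℝ≥0∞ :=
  ⨆ a : A, ⨆ _ : a ≠ 0 ∧ ¬ IsUnit a, elemElasticity a

end OrderElasticity

namespace OrderElasticity

/-! ### Transfer of length sets along a ring homomorphism. -/

section Lengths

/-! Write `T = 𝓞 K`. The conductor is nonzero and radical, so modulo it `T` is a finite product of
finite fields `F i`; associatedness makes the image of `R` a product of subfields `k i`
(`IsAssociatedSubring.mem_iff`). Hence a series over `T` lies over `R` iff each reduction lies over
`k i`. Given `r * s` over `R`, a unit of each `(F i)⟦X⟧` moves both factors over `k i`, since there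
a nonzero series is a power of `X` times a unit. The Chinese remainder theorem glues these units, up
to constants in `k i`, to a unit of `T⟦X⟧`; associatedness supplies its constant term. So
factorizations over `T` descend to `R` up to units, with the same lengths. -/

theorem mem_lengthSet_mul_unit {S : Type*} [CommRing S] {a : S} (ha : ¬ IsUnit a) (u : Sˣ) {n : ℕ}
    (hn : n ∈ lengthSet a) : n ∈ lengthSet (a * u) := by
  obtain ⟨s, hs, rfl, rfl⟩ := hn
  induction s using Multiset.induction with
  | empty => simp at ha
  | cons p s _ =>
    refine ⟨(p * u) ::ₘ s, ?_, ?_, by simp⟩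
    · intro q hq
      rcases Multiset.mem_cons.1 hq with rfl | hq
      · exact (irreducible_mul_units u).2 (hs p (Multiset.mem_cons_self p s))
      · exact hs q (Multiset.mem_cons_of_mem hq)
    · rw [Multiset.prod_cons, Multiset.prod_cons]
      ring

theorem lengthSet_mul_unit {S : Type*} [CommRing S] {a : S} (ha : ¬ IsUnit a) (u : Sˣ) :
    lengthSet (a * u) = lengthSet a := by
  refine Set.Subset.antisymm (fun n hn => ?_) fun n hn => mem_lengthSet_mul_unit ha u hn
  have h := mem_lengthSet_mul_unit (a := a * u)
    (fun h => ha ((Units.isUnit_mul_units a u).1 h)) u⁻¹ hn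
  rwa [Units.mul_inv_cancel_right] at h

/-- Every factorization in `S` of an element of `A` can be moved into `A` by a unit of `S`. -/
def LiftsFactorizations {A S : Type*} [CommRing A] [CommRing S] (g : A →+* S) : Prop :=
  ∀ (f : A) (r s : S), r * s = g f →
    ∃ u : Sˣ, (∃ r' : A, g r' = r * u) ∧ ∃ s' : A, g s' = ↑u⁻¹ * s

variable {A S : Type*} [CommRing A] [CommRing S] {g : A →+* S}

theorem LiftsFactorizations.irreducible_map_iff (hg : LiftsFactorizations g)
    (hinj : Function.Injective g) [IsLocalHom g] {a : A} : Irreducible (g a) ↔ Irreducible a := by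
  refine ⟨fun h => Irreducible.of_map h, fun h => ⟨fun hu => h.1 (isUnit_of_map_unit g a hu), ?_⟩⟩
  intro r s hrs
  obtain ⟨u, ⟨r', hr'⟩, s', hs'⟩ := hg a r s hrs.symm
  have hmul : a = r' * s' := by
    apply hinj
    rw [map_mul, hr', hs', hrs, mul_assoc, Units.mul_inv_cancel_left]
  rcases h.2 hmul with h1 | h1
  · left
    have := h1.map g
    rw [hr'] at this
    exact (Units.isUnit_mul_units r u).1 this
  · right
    have := h1.map g
    rw [hs'] at this
    exact (Units.isUnit_units_mul u⁻¹ s).1 this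

theorem LiftsFactorizations.mem_lengthSet (hg : LiftsFactorizations g)
    (hinj : Function.Injective g) [IsLocalHom g] (n : ℕ) :
    ∀ a : A, ¬ IsUnit a → n ∈ lengthSet (g a) → n ∈ lengthSet a := by
  induction n with
  | zero =>
    rintro a ha ⟨s, -, hsa, hs⟩
    rw [Multiset.card_eq_zero.1 hs, Multiset.prod_zero] at hsa
    exact absurd (isUnit_of_map_unit g a (hsa ▸ isUnit_one)) ha
  | succ n ih =>
    rintro a ha ⟨s, hs, hsa, hcard⟩
    obtain ⟨p, hps⟩ := Multiset.card_pos_iff_exists_mem.1 (by omega : 0 < Multiset.card s)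
    obtain ⟨s, rfl⟩ := Multiset.exists_cons_of_mem hps
    rw [Multiset.card_cons, Nat.add_right_cancel_iff] at hcard
    rw [Multiset.prod_cons] at hsa
    have hs' : ∀ q ∈ s, Irreducible q := fun q hq => hs q (Multiset.mem_cons_of_mem hq)
    obtain ⟨u, ⟨p', hp'⟩, b, hb⟩ := hg a _ _ hsa
    have hmul : p' * b = a := by
      apply hinj
      rw [map_mul, hp', hb, ← hsa, mul_assoc, Units.mul_inv_cancel_left]
    have hpi : Irreducible p' := by
      rw [← hg.irreducible_map_iff hinj, hp']
      exact (irreducible_mul_units u).2 (hs _ (Multiset.mem_cons_self _ s))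
    -- If the cofactor is a unit, no irreducibles remain and `a` itself is the single factor.
    by_cases hub : IsUnit b
    · have hsu : IsUnit s.prod := by
        have := hub.map g
        rw [hb] at this
        exact (Units.isUnit_units_mul u⁻¹ _).1 this
      have hs0 : s = 0 := Multiset.eq_zero_of_forall_notMem fun q hq =>
        (hs' q hq).1 (isUnit_of_dvd_unit (Multiset.dvd_prod hq) hsu)
      rw [hs0, Multiset.card_zero] at hcard
      refine ⟨{a}, fun q hq => ?_, by simp, by simp [← hcard]⟩
      rw [Multiset.mem_singleton.1 hq, ← hmul]
      exact (irreducible_mul_isUnit hub).2 hpi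
    · have hsu : ¬ IsUnit s.prod := fun h => hub <| isUnit_of_map_unit g b <| by
        rw [hb]
        exact (Units.isUnit_units_mul u⁻¹ _).2 h
      have hmem : n ∈ lengthSet (g b) := by
        rw [hb, mul_comm]
        exact mem_lengthSet_mul_unit hsu u⁻¹ ⟨s, hs', rfl, hcard⟩
      obtain ⟨t, ht, htb, htn⟩ := ih b hub hmem
      refine ⟨p' ::ₘ t, fun q hq => ?_, by rw [Multiset.prod_cons, htb, hmul], by simp [htn]⟩
      rcases Multiset.mem_cons.1 hq with rfl | hq
      exacts [hpi, ht q hq]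

theorem LiftsFactorizations.lengthSet_map (hg : LiftsFactorizations g)
    (hinj : Function.Injective g) [IsLocalHom g] {a : A} (ha : ¬ IsUnit a) :
    lengthSet (g a) = lengthSet a := by
  refine Set.Subset.antisymm (fun n hn => hg.mem_lengthSet hinj n a ha hn) ?_
  rintro n ⟨s, hs, rfl, rfl⟩
  refine ⟨s.map g, fun q hq => ?_, (map_multiset_prod g s).symm, Multiset.card_map g s⟩
  obtain ⟨p, hp, rfl⟩ := Multiset.mem_map.1 hq
  exact (hg.irreducible_map_iff hinj).2 (hs p hp)

theorem LiftsFactorizations.elemElasticity_map (hg : LiftsFactorizations g)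
    (hinj : Function.Injective g) [IsLocalHom g] {a : A} (ha : ¬ IsUnit a) :
    elemElasticity (g a) = elemElasticity a := by
  unfold elemElasticity
  rw [hg.lengthSet_map hinj ha]

theorem LiftsFactorizations.ringElasticity_eq (hg : LiftsFactorizations g)
    (hinj : Function.Injective g) [IsLocalHom g]
    (hassoc : ∀ s : S, ∃ (a : A) (u : Sˣ), s = g a * u) :
    ringElasticity A = ringElasticity S := by
  refine le_antisymm (iSup₂_le fun a ha => ?_) (iSup₂_le fun s hs => ?_)
  · rw [← hg.elemElasticity_map hinj ha.2]
    exact le_iSup₂_of_le (g a) ⟨(map_ne_zero_iff g hinj).2 ha.1,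
      fun h => ha.2 (isUnit_of_map_unit g a h)⟩ le_rfl
  · obtain ⟨a, u, rfl⟩ := hassoc s
    have hu : ¬ IsUnit (g a) := fun h => hs.2 (h.mul u.isUnit)
    have ha : ¬ IsUnit a := fun h => hu (h.map g)
    have hlen : elemElasticity (g a * u) = elemElasticity a := by
      rw [← hg.elemElasticity_map hinj ha]
      unfold elemElasticity
      rw [lengthSet_mul_unit hu]
    rw [hlen]
    exact le_iSup₂_of_le a ⟨fun h => hs.1 (by rw [h, map_zero, zero_mul]), ha⟩ le_rfl

/-- An element of `S` is associated to an element of `A`: factor `0 = s * 0`. -/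
theorem LiftsFactorizations.exists_eq_map_mul_unit (hg : LiftsFactorizations g) (s : S) :
    ∃ (a : A) (u : Sˣ), s = g a * u := by
  obtain ⟨u, ⟨a, ha⟩, -⟩ := hg 0 s 0 (by simp)
  exact ⟨a, u⁻¹, by rw [ha, Units.mul_inv_cancel_right]⟩

end Lengths

/-! ### Descent of power series factorizations. -/

section PowerSeries

open PowerSeries

/-- Take `u` to be the unit part of `r`: what is left of `r` is a power of `X`, and `u * s` is a
shift of `r * s`. -/
theorem exists_unit_coeff_mem_of_ne_zero {F : Type*} [Field F] (k : Subfield F) {r s : F⟦X⟧}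
    (h : ∀ n, coeff n (r * s) ∈ k) (hr : r ≠ 0) :
    ∃ u : F⟦X⟧ˣ, (∀ n, coeff n (r * (u⁻¹ : F⟦X⟧ˣ).val) ∈ k) ∧ ∀ n, coeff n (u.val * s) ∈ k := by
  obtain ⟨u, hu⟩ := isUnit_divided_by_X_pow_order hr
  have hru : r = (X : F⟦X⟧) ^ r.order.toNat * u.val := by rw [hu, X_pow_order_mul_divXPowOrder]
  refine ⟨u, fun n => ?_, fun n => ?_⟩
  · rw [hru, Units.mul_inv_cancel_right, coeff_X_pow]
    split_ifs
    exacts [k.one_mem, k.zero_mem]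
  · have := h (n + r.order.toNat)
    rwa [hru, mul_assoc, ← hru, coeff_X_pow_mul] at this

theorem exists_unit_coeff_mem {F : Type*} [Field F] (k : Subfield F) {r s : F⟦X⟧}
    (h : ∀ n, coeff n (r * s) ∈ k) :
    ∃ u : F⟦X⟧ˣ, (∀ n, coeff n (r * u.val) ∈ k) ∧ ∀ n, coeff n ((u⁻¹ : F⟦X⟧ˣ).val * s) ∈ k := by
  by_cases hr : r = 0
  · by_cases hs : s = 0
    · exact ⟨1, by simp [hr, k.zero_mem], by simp [hs, k.zero_mem]⟩
    · obtain ⟨u, h1, h2⟩ := exists_unit_coeff_mem_of_ne_zero k (r := s) (s := r)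
        (by rwa [mul_comm]) hs
      exact ⟨u, by rwa [mul_comm], by rwa [mul_comm]⟩
  · obtain ⟨u, h1, h2⟩ := exists_unit_coeff_mem_of_ne_zero k h hr
    exact ⟨u⁻¹, h1, by rwa [inv_inv]⟩

variable {T : Type*} [CommRing T] {ι : Type*} {F : ι → Type*} [∀ i, Field (F i)]
  {φ : ∀ i, T →+* F i} {k : ∀ i, Subfield (F i)}

/-- Only the constant term decides whether a series is a unit. It comes from `hunit`, which costs
the factors `κ i`; the higher coefficients are free lifts. -/
theorem exists_unit_map_eq_C_mul (hsurj : ∀ c : ∀ i, F i, ∃ t, ∀ i, φ i t = c i)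
    (hunit : ∀ c : ∀ i, F i, (∀ i, c i ≠ 0) → ∃ u : Tˣ, ∀ i, φ i u / c i ∈ k i)
    (v : ∀ i, (F i)⟦X⟧ˣ) :
    ∃ (u : T⟦X⟧ˣ) (κ : ∀ i, F i), (∀ i, κ i ∈ k i ∧ κ i ≠ 0) ∧
      ∀ i, map (φ i) (u : T⟦X⟧) = C (κ i) * v i := by
  have hv : ∀ i, constantCoeff (v i : (F i)⟦X⟧) ≠ 0 := fun i =>
    ((v i).isUnit.map constantCoeff).ne_zero
  obtain ⟨u₀, hu₀⟩ := hunit (fun i => constantCoeff (v i : (F i)⟦X⟧)) hv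
  set κ : ∀ i, F i := fun i => φ i u₀ / constantCoeff (v i : (F i)⟦X⟧) with hκ
  choose t ht using fun n : ℕ => hsurj fun i => κ i * coeff n (v i : (F i)⟦X⟧)
  let w : T⟦X⟧ := PowerSeries.mk fun n => if n = 0 then (u₀ : T) else t n
  have hw : IsUnit w := by
    rw [isUnit_iff_constantCoeff, ← coeff_zero_eq_constantCoeff_apply, coeff_mk, if_pos rfl]
    exact u₀.isUnit
  obtain ⟨u, hu⟩ := hw
  refine ⟨u, κ, fun i => ⟨hu₀ i, div_ne_zero (u₀.isUnit.map (φ i)).ne_zero (hv i)⟩, fun i => ?_⟩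
  rw [hu]
  ext n
  rw [coeff_map, coeff_mk, coeff_C_mul]
  split_ifs with hn
  · rw [hn, coeff_zero_eq_constantCoeff_apply, hκ, div_mul_cancel₀ _ (hv i)]
  · exact ht n i

theorem exists_map_subtype_eq (R : Subring T) {f : T⟦X⟧} (hf : ∀ n, coeff n f ∈ R) :
    ∃ g : R⟦X⟧, map R.subtype g = f :=
  ⟨PowerSeries.mk fun n => ⟨coeff n f, hf n⟩, by ext n; simp⟩

theorem liftsFactorizations_map_subtype {R : Subring T}
    (hmem : ∀ t, t ∈ R ↔ ∀ i, φ i t ∈ k i)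
    (hsurj : ∀ c : ∀ i, F i, ∃ t, ∀ i, φ i t = c i)
    (hunit : ∀ c : ∀ i, F i, (∀ i, c i ≠ 0) → ∃ u : Tˣ, ∀ i, φ i u / c i ∈ k i) :
    LiftsFactorizations (map R.subtype) := by
  intro f r s hf
  have hcoeff : ∀ i n, coeff n (map (φ i) r * map (φ i) s) ∈ k i := fun i n => by
    rw [← map_mul, hf, coeff_map, coeff_map]
    exact (hmem _).1 (coeff n f).2 i
  choose v hv₁ hv₂ using fun i => exists_unit_coeff_mem (k i) (hcoeff i)
  obtain ⟨u, κ, hκ, hu⟩ := exists_unit_map_eq_C_mul hsurj hunit v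
  have hu' : ∀ i, map (φ i) ((u⁻¹ : T⟦X⟧ˣ) : T⟦X⟧) = C (κ i)⁻¹ * ((v i)⁻¹ : (F i)⟦X⟧ˣ) := by
    intro i
    have h1 : map (φ i) (u : T⟦X⟧) * map (φ i) ((u⁻¹ : T⟦X⟧ˣ) : T⟦X⟧) = 1 := by
      rw [← map_mul, Units.mul_inv, map_one]
    have h2 : map (φ i) (u : T⟦X⟧) * (C (κ i)⁻¹ * ((v i)⁻¹ : (F i)⟦X⟧ˣ)) = 1 := by
      rw [hu, mul_mul_mul_comm, ← map_mul, mul_inv_cancel₀ (hκ i).2, Units.mul_inv, map_one,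
        one_mul]
    exact (u.isUnit.map (map (φ i))).mul_left_cancel (h1.trans h2.symm)
  refine ⟨u, exists_map_subtype_eq R fun n => (hmem _).2 fun i => ?_,
    exists_map_subtype_eq R fun n => (hmem _).2 fun i => ?_⟩
  · rw [← coeff_map, map_mul, hu, mul_left_comm, coeff_C_mul]
    exact (k i).mul_mem (hκ i).1 (hv₁ i n)
  · rw [← coeff_map, map_mul, hu', mul_assoc, coeff_C_mul]
    exact (k i).mul_mem ((k i).inv_mem (hκ i).1) (hv₂ i n)

theorem isLocalHom_subtype {R : Subring T} (hmem : ∀ t, t ∈ R ↔ ∀ i, φ i t ∈ k i) :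
    IsLocalHom R.subtype := by
  refine ⟨fun a ha => ?_⟩
  obtain ⟨u, hu⟩ := ha
  have hinv : ((u⁻¹ : Tˣ) : T) ∈ R := (hmem _).2 fun i => by
    have h : φ i ((u⁻¹ : Tˣ) : T) = (φ i (u : T))⁻¹ :=
      eq_inv_of_mul_eq_one_left (by rw [← map_mul, Units.inv_mul, map_one])
    rw [h, hu]
    exact (k i).inv_mem ((hmem _).1 a.2 i)
  refine IsUnit.of_mul_eq_one ⟨_, hinv⟩ (Subtype.ext ?_)
  change (R.subtype a) * ((u⁻¹ : Tˣ) : T) = 1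
  rw [← hu, Units.mul_inv]

end PowerSeries

/-! ### The conductor of an order is nonzero. -/

section Conductor

theorem conductorIdeal_le {T : Type*} [CommRing T] (R : Subring T) {t : T}
    (ht : t ∈ conductorIdeal R) : t ∈ R := by
  simpa using ht 1

variable {K : Type*} [Field K] [NumberField K] {R : Subring (𝓞 K)}

theorem IsOrder.exists_nsmul_mem (hR : IsOrder K R) (t : 𝓞 K) : ∃ n : ℕ, n ≠ 0 ∧ n • t ∈ R := by
  have key : ∀ x ∈ Submodule.span ℚ ((fun a : 𝓞 K => (a : K)) '' (R : Set (𝓞 K))),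
      ∃ n : ℕ, n ≠ 0 ∧ ∃ r ∈ R, n • x = (r : K) := by
    intro x hx
    induction hx using Submodule.span_induction with
    | mem x hx =>
      obtain ⟨r, hr, rfl⟩ := hx
      exact ⟨1, one_ne_zero, r, hr, one_smul _ _⟩
    | zero => exact ⟨1, one_ne_zero, 0, R.zero_mem, by simp⟩
    | add x y _ _ hx hy =>
      obtain ⟨m, hm, r, hr, hmr⟩ := hx
      obtain ⟨n, hn, s, hs, hns⟩ := hy
      refine ⟨m * n, mul_ne_zero hm hn, n • r + m • s,
        R.add_mem (R.nsmul_mem hr n) (R.nsmul_mem hs m), ?_⟩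
      simp only [nsmul_eq_mul, map_add, map_mul, map_natCast, ← hmr, ← hns, Nat.cast_mul]
      ring
    | smul q x _ hx =>
      obtain ⟨m, hm, r, hr, hmr⟩ := hx
      refine ⟨q.den * m, mul_ne_zero q.den_ne_zero hm, q.num • r, R.zsmul_mem hr _, ?_⟩
      have hq : ((q.den : ℚ) : K) * (q : K) = (q.num : K) := by
        rw [← Rat.cast_mul, Rat.den_mul_eq_num, Rat.cast_intCast]
      rw [Rat.cast_natCast] at hq
      simp only [nsmul_eq_mul, zsmul_eq_mul, map_mul, map_intCast, ← hmr, Nat.cast_mul,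
        Rat.smul_def, ← hq]
      ring
  obtain ⟨n, hn, r, hr, h⟩ := key (t : K) (hR ▸ Submodule.mem_top)
  refine ⟨n, hn, ?_⟩
  have : n • t = r := NumberField.RingOfIntegers.ext (by rw [← h]; simp)
  rwa [this]

theorem IsOrder.conductorIdeal_ne_bot (hR : IsOrder K R) : conductorIdeal R ≠ ⊥ := by
  let b := NumberField.RingOfIntegers.basis K
  choose n hn hmem using fun i => hR.exists_nsmul_mem (b i)
  have hN : ∏ i, n i ≠ 0 := Finset.prod_ne_zero_iff.2 fun i _ => hn i
  have h : ((∏ i, n i : ℕ) : 𝓞 K) ∈ conductorIdeal R := by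
    intro t
    rw [← b.sum_repr t, Finset.mul_sum]
    refine R.sum_mem fun i _ => ?_
    obtain ⟨m, hm⟩ := Finset.dvd_prod_of_mem n (Finset.mem_univ i)
    have : ((∏ i, n i : ℕ) : 𝓞 K) * b.repr t i • b i = (m * b.repr t i) • n i • b i := by
      rw [hm]
      simp only [zsmul_eq_mul, nsmul_eq_mul]
      push_cast
      ring
    rw [this]
    exact R.zsmul_mem (hmem i) _
  intro hbot
  rw [hbot, Ideal.mem_bot, Nat.cast_eq_zero] at h
  exact hN h

end Conductor

/-! ### The image of `R` in the residue fields. -/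

section Quotients

variable {T : Type*} [CommRing T] {R : Subring T}

/-- The image of a subring in a quotient field that is finite, as a subfield. -/
noncomputable def imageSubfield (R : Subring T) {F : Type*} [Field F] [Finite F] (φ : T →+* F) :
    Subfield F where
  __ := R.map φ
  inv_mem' x hx := by
    have := Fintype.ofFinite F
    by_cases h0 : x = 0
    · rw [h0, inv_zero]
      exact (R.map φ).zero_mem
    -- In a field with `q` elements the inverse is the power `x ^ (q - 2)`.
    · have h := FiniteField.pow_card_sub_one_eq_one x h0
      have h2 : Fintype.card F - 1 = Fintype.card F - 2 + 1 := by
        have := Fintype.one_lt_card (α := F)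
        omega
      rw [h2, pow_succ] at h
      rw [← eq_inv_of_mul_eq_one_left h]
      exact (R.map φ).pow_mem hx _

theorem mem_imageSubfield {F : Type*} [Field F] [Finite F] {φ : T →+* F} {x : F} :
    x ∈ imageSubfield R φ ↔ ∃ r ∈ R, φ r = x :=
  Subring.mem_map

variable {ι : Type*} {F : ι → Type*} [∀ i, Field (F i)] [∀ i, Finite (F i)] {φ : ∀ i, T →+* F i}

theorem IsAssociatedSubring.exists_unit_div_mem (hassoc : IsAssociatedSubring R)
    (hsurj : ∀ c : ∀ i, F i, ∃ t, ∀ i, φ i t = c i) (c : ∀ i, F i) (_ : ∀ i, c i ≠ 0) :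
    ∃ u : Tˣ, ∀ i, φ i u / c i ∈ imageSubfield R (φ i) := by
  obtain ⟨t, ht⟩ := hsurj c
  obtain ⟨r, hr, u, rfl⟩ := hassoc t
  refine ⟨u, fun i => ?_⟩
  have hr' : φ i r ∈ imageSubfield R (φ i) := mem_imageSubfield.2 ⟨r, hr, rfl⟩
  have hu : φ i (u : T) ≠ 0 := (u.isUnit.map (φ i)).ne_zero
  -- As `c = r * u` in each residue field, `u / c` is the inverse of `r`.
  rw [← ht i, map_mul, div_mul_cancel_right₀ hu]
  exact (imageSubfield R (φ i)).inv_mem hr'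

theorem IsAssociatedSubring.mem_iff [Finite ι] (hassoc : IsAssociatedSubring R)
    (hsurj : ∀ c : ∀ i, F i, ∃ t, ∀ i, φ i t = c i)
    (hker : ∀ t, (∀ i, φ i t = 0) → t ∈ R) (t : T) :
    t ∈ R ↔ ∀ i, φ i t ∈ imageSubfield R (φ i) := by
  classical
  refine ⟨fun ht i => mem_imageSubfield.2 ⟨t, ht, rfl⟩, fun h => ?_⟩
  have := Fintype.ofFinite ι
  have := fun i => Fintype.ofFinite (F i)
  let N := ∏ i, (Fintype.card (F i) - 1)
  have hN : N ≠ 0 := Finset.prod_ne_zero_iff.2 fun i _ => by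
    have := Fintype.one_lt_card (α := F i)
    omega
  have hpow : ∀ i (x : F i), x ≠ 0 → x ^ N = 1 := fun i x hx => by
    obtain ⟨m, hm⟩ := Finset.dvd_prod_of_mem (fun i => Fintype.card (F i) - 1) (Finset.mem_univ i)
    rw [show N = _ from hm, pow_mul, FiniteField.pow_card_sub_one_eq_one x hx, one_pow]
  -- An associate `r ∈ R` of a lifted idempotent has the same zero residues, and the `N`-th power
  -- turns its nonzero residue into `1`.
  have hidem : ∀ i, ∃ e ∈ R, ∀ j, φ j e = if j = i then 1 else 0 := fun i => by
    obtain ⟨e, he⟩ := hsurj fun j => if j = i then 1 else 0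
    obtain ⟨r, hr, u, rfl⟩ := hassoc e
    refine ⟨r ^ N, R.pow_mem hr N, fun j => ?_⟩
    have hj := he j
    rw [map_mul] at hj
    have hu : φ j (u : T) ≠ 0 := (u.isUnit.map (φ j)).ne_zero
    rw [map_pow]
    split_ifs at hj ⊢ with hji
    · exact hpow j _ (left_ne_zero_of_mul (hj ▸ one_ne_zero))
    · rw [(mul_eq_zero.1 hj).resolve_right hu, zero_pow hN]
  choose e heR he using hidem
  choose r hrR hr using fun i => mem_imageSubfield.1 (h i)
  have hsum : ∑ i, e i * r i ∈ R := R.sum_mem fun i _ => R.mul_mem (heR i) (hrR i)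
  have hsub : t - ∑ i, e i * r i ∈ R := hker _ fun j => by
    rw [map_sub, map_sum, Finset.sum_eq_single j]
    · rw [map_mul, he, if_pos rfl, one_mul, hr, sub_self]
    · intro i _ hij
      rw [map_mul, he, if_neg hij.symm, zero_mul]
    · exact fun hj => absurd (Finset.mem_univ j) hj
  simpa using R.add_mem hsub hsum

end Quotients

theorem liftsFactorizations_powerSeries {K : Type*} [Field K] [NumberField K]
    {R : Subring (𝓞 K)} (hR : IsOrder K R) (hassoc : IsAssociatedSubring R)
    (hrad : (conductorIdeal R).IsRadical) :
    LiftsFactorizations (PowerSeries.map R.subtype) ∧ IsLocalHom R.subtype := by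
  let I := conductorIdeal R
  have hI : I ≠ ⊥ := hR.conductorIdeal_ne_bot
  have hfin : Finite I.minimalPrimes := I.finite_minimalPrimes_of_isNoetherianRing
  have hbot : ∀ p : I.minimalPrimes, p.1 ≠ ⊥ := fun p h => hI (le_bot_iff.1 (h ▸ p.2.1.2))
  have hmax : ∀ p : I.minimalPrimes, p.1.IsMaximal := fun p => p.2.1.1.isMaximal (hbot p)
  let _ : ∀ p : I.minimalPrimes, Field (𝓞 K ⧸ p.1) := fun p => Ideal.Quotient.field p.1
  have _ : ∀ p : I.minimalPrimes, Finite (𝓞 K ⧸ p.1) := fun p =>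
    p.1.finiteQuotientOfFreeOfNeBot (hbot p)
  let φ : ∀ p : I.minimalPrimes, 𝓞 K →+* 𝓞 K ⧸ p.1 := fun p => Ideal.Quotient.mk p.1
  have hsurj : ∀ c : ∀ p : I.minimalPrimes, 𝓞 K ⧸ p.1, ∃ t, ∀ p, φ p t = c p := fun c =>
    Ideal.pi_quotient_surjective (I := fun p : I.minimalPrimes => p.1) (fun p q hpq =>
      Ideal.isCoprime_iff_sup_eq.2 ((hmax p).coprime_of_ne (hmax q)
        (Subtype.coe_injective.ne hpq))) c
  -- Radicality: the conductor is the intersection of its minimal primes.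
  have hker : ∀ t, (∀ p, φ p t = 0) → t ∈ R := fun t ht => conductorIdeal_le R <| by
    rw [← hrad.radical, ← Ideal.sInf_minimalPrimes, Submodule.mem_sInf]
    exact fun p hp => Ideal.Quotient.eq_zero_iff_mem.1 (ht ⟨p, hp⟩)
  have hmem := hassoc.mem_iff hsurj hker
  exact ⟨liftsFactorizations_map_subtype hmem hsurj (hassoc.exists_unit_div_mem hsurj),
    isLocalHom_subtype hmem⟩

end OrderElasticity

theorem mainTheorem5 {K : Type*} [Field K] [NumberField K] (R : Subring (𝓞 K))
    (hR : OrderElasticity.IsOrder K R)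
    (hassoc : OrderElasticity.IsAssociatedSubring R)
    (hrad : (OrderElasticity.conductorIdeal R).IsRadical) :
    (∀ f : PowerSeries R, f ≠ 0 → ¬ IsUnit f →
      OrderElasticity.elemElasticity f =
        OrderElasticity.elemElasticity (PowerSeries.map R.subtype f)) ∧
    OrderElasticity.ringElasticity (PowerSeries R) =
      OrderElasticity.ringElasticity (PowerSeries (𝓞 K)) := by
  obtain ⟨hlift, hlocal⟩ := OrderElasticity.liftsFactorizations_powerSeries hR hassoc hrad
  have hinj : Function.Injective (PowerSeries.map R.subtype) :=
    PowerSeries.map_injective _ Subtype.coe_injective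
  have : IsLocalHom (PowerSeries.map R.subtype) := inferInstance
  exact ⟨fun f _ hf => (hlift.elemElasticity_map hinj hf).symm,
    hlift.ringElasticity_eq hinj hlift.exists_eq_map_mul_unit⟩
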